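/- **Definitions.** Fix countably infinite disjoint sets of variables $x,y,\dots$ and of propositional symbols $p,q,\dots$. The formulas of $\mu\mathsf{MALL}$ are generated by $$A,B ::= x \mid p \mid \neg p \mid 1 \mid \bot \mid 0 \mid \top \mid A\otimes B \mid A ⅋ B \mid A\oplus B \mid A \mathbin{\&} B \mid \mu x\,A \mid \nu x\,A ,$$ where $\mu,\nu$ bind variables and formulas are taken up to renaming of bound variables. For an ordinal $\alpha$, the formulas of $\mu\mathsf{MALL}^{\alpha}$ are obtained by allowing annotated fixed points $\mu^\beta x\,A$ and $\nu^\beta x\,A$ for every $\beta\le\alpha$; $\mu x\,A$ and $\nu x\,A$ are identified with $\mu^\alpha x\,A$ and $\nu^\alpha x\,A$. Negation is extended to all formulas by De Morgan duality ($1/\bot$, $0/\top$, $\otimes/⅋$, $\oplus/\&$, $\mu^\beta/\nu^\beta$), with $\neg x = x$ for variables. Sequents are finite multisets of formulas. The system $\mu\mathsf{MALL}^{\alpha}$ consists of the usual one-sided rules of multiplicative additive linear logic with cut, namely: $A,\neg A$; from $\Gamma,A$ and $\Delta,\neg A$ infer $\Gamma,\Delta$; $1$; from $\Gamma$ infer $\Gamma,\bot$;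 $\Gamma,\top$; from $\Gamma,A$ and $\Delta,B$ infer $\Gamma,\Delta,A\otimes B$; from $\Gamma,A,B$ infer $\Gamma,A⅋B$; from $\Gamma,A_i$ infer $\Gamma,A_0\oplus A_1$; from $\Gamma,A$ and $\Gamma,B$ infer $\Gamma,A\mathbin{\&}B$; together with the following rules for all $\beta\le\alpha$: * from $\Gamma, A(\mu^\gamma x\,A(x))$, for some $\gamma<\beta$, infer $\Gamma,\mu^\beta x\,A(x)$; * from the family of premisses $\Gamma, A(\nu^\gamma x\,A(x))$, one for each $\gamma<\beta$, infer $\Gamma,\nu^\beta x\,A(x)$. Derivations are wellfounded, possibly infinitely branching, trees. The provability problem of $\mu\mathsf{MALL}^{\alpha}$ is the set $\mathrm{Th}_\alpha\subseteq\mathbb N$ of (standard) Gödel numbers of those sequents of (unannotated) $\mu\mathsf{MALL}$ formulas that are provable in $\mu\mathsf{MALL}^{\alpha}$. **Proposition.** For every ordinal $\alpha\ge\omega$ (in particular for every computable one), provability in $\mu\mathsf{MALL}^{\alpha}$ is $\Sigma^0_1$-hard: every computably enumerable set $P\subseteq\mathbb N$ is many-one reducible to $\mathrm{Th}_\alpha$,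 and the Turing jump $\emptyset'$ is Turing reducible to $\mathrm{Th}_\alpha$. -/

import Mathlib

universe u v

namespace MuMALL

/-- Formulas of multiplicative additive linear logic with fixed points, where every fixed point
carries an annotation from `ι`.  Propositional symbols are the natural numbers.  Formulas are taken
up to renaming of bound variables, in de Bruijn style: `var n` refers to the `n`-th enclosing
fixed point (counted from `0`, from the inside), and is free if there are at most `n` of them. -/
inductive Fml (ι : Type u) : Type u
  | var (n : ℕ) : Fml ι
  | prop (p : ℕ) : Fml ι
  | nprop (p : ℕ) : Fml ι
  | one : Fml ι
  | bot : Fml ι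
  | zero : Fml ι
  | top : Fml ι
  | tensor (A B : Fml ι) : Fml ι
  | par (A B : Fml ι) : Fml ι
  | plus (A B : Fml ι) : Fml ι
  | with (A B : Fml ι) : Fml ι
  | mu (i : ι) (A : Fml ι) : Fml ι
  | nu (i : ι) (A : Fml ι) : Fml ι

namespace Fml

variable {ι : Type u} {κ : Type v}

/-- Negation, by De Morgan duality; variables are self-dual. -/
def neg : Fml ι → Fml ι
  | var n => var n
  | prop p => nprop p
  | nprop p => prop p
  | one => bot
  | bot => one
  | zero => top
  | top => zero
  | tensor A B => par A.neg B.neg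
  | par A B => tensor A.neg B.neg
  | plus A B => .with A.neg B.neg
  | .with A B => plus A.neg B.neg
  | mu i A => nu i A.neg
  | nu i A => mu i A.neg

/-- Extension of a renaming of variables under one binder. -/
def upRen (ρ : ℕ → ℕ) : ℕ → ℕ
  | 0 => 0
  | n + 1 => ρ n + 1

/-- Renaming of free variables. -/
def rename : (ℕ → ℕ) → Fml ι → Fml ι
  | ρ, var n => var (ρ n)
  | _, prop p => prop p
  | _, nprop p => nprop p
  | _, one => one
  | _, bot => bot
  | _, zero => zero
  | _, top => top
  | ρ, tensor A B => tensor (A.rename ρ) (B.rename ρ)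
  | ρ, par A B => par (A.rename ρ) (B.rename ρ)
  | ρ, plus A B => plus (A.rename ρ) (B.rename ρ)
  | ρ, .with A B => .with (A.rename ρ) (B.rename ρ)
  | ρ, mu i A => mu i (A.rename (upRen ρ))
  | ρ, nu i A => nu i (A.rename (upRen ρ))

/-- Extension of a substitution under one binder. -/
def upSub (σ : ℕ → Fml ι) : ℕ → Fml ι
  | 0 => var 0
  | n + 1 => (σ n).rename Nat.succ

/-- Simultaneous capture-avoiding substitution for the free variables. -/
def subst : (ℕ → Fml ι) → Fml ι → Fml ι
  | σ, var n => σ n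
  | _, prop p => prop p
  | _, nprop p => nprop p
  | _, one => one
  | _, bot => bot
  | _, zero => zero
  | _, top => top
  | σ, tensor A B => tensor (A.subst σ) (B.subst σ)
  | σ, par A B => par (A.subst σ) (B.subst σ)
  | σ, plus A B => plus (A.subst σ) (B.subst σ)
  | σ, .with A B => .with (A.subst σ) (B.subst σ)
  | σ, mu i A => mu i (A.subst (upSub σ))
  | σ, nu i A => nu i (A.subst (upSub σ))

/-- The substitution of `B` for the variable `0`; the other variables move down by one. -/
def single (B : Fml ι) : ℕ → Fml ι
  | 0 => B
  | n + 1 => var n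

/-- `A.inst B` is `A(B)`, where `A = A(x)` is the body of a fixed point `μ x A(x)`
or `ν x A(x)`. -/
def inst (A B : Fml ι) : Fml ι := A.subst (single B)

/-- Change of the annotations of the fixed points. -/
def mapAnn (f : ι → κ) : Fml ι → Fml κ
  | var n => var n
  | prop p => prop p
  | nprop p => nprop p
  | one => one
  | bot => bot
  | zero => zero
  | top => top
  | tensor A B => tensor (A.mapAnn f) (B.mapAnn f)
  | par A B => par (A.mapAnn f) (B.mapAnn f)
  | plus A B => plus (A.mapAnn f) (B.mapAnn f)
  | .with A B => .with (A.mapAnn f) (B.mapAnn f)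
  | mu i A => mu (f i) (A.mapAnn f)
  | nu i A => nu (f i) (A.mapAnn f)

end Fml

/-- Formulas of `μMALL`: the fixed points `μ x A` and `ν x A` carry no information. -/
abbrev PlainFml : Type := Fml Unit

/-- Formulas of `μMALL^α`: the fixed points `μ^β x A` and `ν^β x A` are annotated with
ordinals `β ≤ α`. -/
abbrev OrdFml (α : Ordinal.{u}) : Type (u + 1) := Fml (Set.Iic α)

/-- A `μMALL` formula read as a `μMALL^α` formula: `μ` is `μ^α` and `ν` is `ν^α`. -/
def PlainFml.toOrd (α : Ordinal.{u}) (A : PlainFml) : OrdFml α :=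
  A.mapAnn fun _ => ⟨α, le_refl α⟩

open Fml in
/-- Provability in `μMALL^α`.  Sequents are finite multisets of formulas; the rules are those of
one-sided `MALL` (with cut) and the ordinal-branching rules for `μ^β` and `ν^β`, `β ≤ α`.
Derivations are wellfounded, possibly infinitely branching, trees. -/
inductive Provable (α : Ordinal.{u}) : Multiset (OrdFml α) → Prop
  | id (A : OrdFml α) : Provable α {A, A.neg}
  | cut (Γ Δ : Multiset (OrdFml α)) (A : OrdFml α) :
      Provable α (A ::ₘ Γ) → Provable α (A.neg ::ₘ Δ) → Provable α (Γ + Δ)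
  | one : Provable α {one}
  | bot (Γ : Multiset (OrdFml α)) : Provable α Γ → Provable α (bot ::ₘ Γ)
  | top (Γ : Multiset (OrdFml α)) : Provable α (top ::ₘ Γ)
  | tensor (Γ Δ : Multiset (OrdFml α)) (A B : OrdFml α) :
      Provable α (A ::ₘ Γ) → Provable α (B ::ₘ Δ) → Provable α (tensor A B ::ₘ (Γ + Δ))
  | par (Γ : Multiset (OrdFml α)) (A B : OrdFml α) :
      Provable α (A ::ₘ B ::ₘ Γ) → Provable α (par A B ::ₘ Γ)
  | plusLeft (Γ : Multiset (OrdFml α)) (A B : OrdFml α) :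
      Provable α (A ::ₘ Γ) → Provable α (plus A B ::ₘ Γ)
  | plusRight (Γ : Multiset (OrdFml α)) (A B : OrdFml α) :
      Provable α (B ::ₘ Γ) → Provable α (plus A B ::ₘ Γ)
  | with (Γ : Multiset (OrdFml α)) (A B : OrdFml α) :
      Provable α (A ::ₘ Γ) → Provable α (B ::ₘ Γ) → Provable α (Fml.with A B ::ₘ Γ)
  | mu (Γ : Multiset (OrdFml α)) (β γ : Set.Iic α) (A : OrdFml α) (hγ : γ < β) :
      Provable α (A.inst (mu γ A) ::ₘ Γ) → Provable α (mu β A ::ₘ Γ)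
  | nu (Γ : Multiset (OrdFml α)) (β : Set.Iic α) (A : OrdFml α) :
      (∀ γ : Set.Iic α, γ < β → Provable α (A.inst (nu γ A) ::ₘ Γ)) → Provable α (nu β A ::ₘ Γ)

/-- Gödel numbers of `μMALL` formulas. -/
def PlainFml.code : PlainFml → ℕ
  | .var n => Nat.pair 0 n
  | .prop p => Nat.pair 1 p
  | .nprop p => Nat.pair 2 p
  | .one => Nat.pair 3 0
  | .bot => Nat.pair 4 0
  | .zero => Nat.pair 5 0
  | .top => Nat.pair 6 0
  | .tensor A B => Nat.pair 7 (Nat.pair (code A) (code B))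
  | .par A B => Nat.pair 8 (Nat.pair (code A) (code B))
  | .plus A B => Nat.pair 9 (Nat.pair (code A) (code B))
  | .with A B => Nat.pair 10 (Nat.pair (code A) (code B))
  | .mu _ A => Nat.pair 11 (code A)
  | .nu _ A => Nat.pair 12 (code A)

/-- Gödel number of a `μMALL` sequent, presented by a list of its formulas. -/
def seqCode (Γ : List PlainFml) : ℕ :=
  Encodable.encode (Γ.map PlainFml.code)

/-- The provability problem of `μMALL^α`: the Gödel numbers of the `μMALL` sequents that are
provable in `μMALL^α`. -/
def Th (α : Ordinal.{u}) : Set ℕ :=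
  {n | ∃ Γ : List PlainFml, n = seqCode Γ ∧
    Provable α (Γ.map (PlainFml.toOrd α) : Multiset (OrdFml α))}

end MuMALL

/-- The characteristic function of a set of natural numbers, as an oracle. -/
noncomputable def oracleOf (S : Set ℕ) : ℕ →. ℕ :=
  open Classical in fun n => Part.some (if n ∈ S then 1 else 0)

/-- The Turing jump of the empty set: the `n` for which the `n`-th partial computable function is
defined at `n`. -/
def emptyJump : Set ℕ :=
  {n | ((Denumerable.ofNat Nat.Partrec.Code n).eval n).Dom}

/-- `S` is `Σ⁰₁`-hard under many-one reductions: every computably enumerable set many-one reduces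
to `S`. -/
def SigmaOneHardManyOne (S : Set ℕ) : Prop :=
  ∀ P : ℕ → Prop, REPred P → ManyOneReducible P (fun n => n ∈ S)

/-- `S` is `Σ⁰₁`-hard under Turing reductions: the jump of the empty set is Turing reducible
to `S`. -/
def SigmaOneHardTuring (S : Set ℕ) : Prop :=
  TuringReducible (oracleOf emptyJump) (oracleOf S)

/-!
Computations with registers are encoded as derivations.  A loop program acts on a multiset of
register names, and a state is represented in a sequent by the propositional symbols of its
registers.  The formula `Fml.run i N p K` runs the program `p` and continues as `K`: incrementing
`r` is `r ⅋ K`, and a loop on `r` is the fixed point `μ x ((¬r ⊗ [p] x) ⊕ (Z & K))`, where the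
formula `Z` (`Fml.drain`), itself a fixed point, consumes all registers except `r` and thus tests
that `r` is empty.

A halting run passes through each loop finitely often, so it unfolds to a derivation in which all
annotations that replace the initial `α` are natural numbers; this is where `ω ≤ α` is used
(`provable_run`).

Conversely, derivations are interpreted in phase semantics, with the fixed points `μ^β` and `ν^β`
interpreted by transfinite iteration (`Provable.sound`).  The phase space consists of states
together with tests `some X`, one for every set `X` of states, and a state passes `some X` if it
belongs to `X`.  Hence all sets of states are facts, the connectives used in `Fml.run` have their
set-theoretic meaning on them, and `Fml.run i N p K` denotes only states from which `p` halts
(`evalStates_run_subset`).  As negation fixes variables, free variables have to denote facts that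
are their own orthogonals; a further test `none` provides one (`orth_none`).

Loop programs compute all primitive recursive functions (`computes_of_primrec`), and one more loop,
searching for a number of steps within which a given code halts, makes every computably enumerable
set the domain of a loop program (`exists_prog_of_rePred`).  The program being fixed, only the
number of copies of the input register in the sequent depends on the input, so the reduction is
primitive recursive.  The Turing reduction is the many-one reduction of the computably enumerable
set `∅'`.
-/

/-! ### Loop programs -/

namespace MuMALL

/-- Programs over registers holding natural numbers: `loop r p` stands for
`while r ≠ 0 do (r := r - 1; p)`. -/
inductive Prog : Type
  | skip : Prog
  | inc (r : ℕ) : Prog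
  | seq (p q : Prog) : Prog
  | loop (r : ℕ) (p : Prog) : Prog

/-- `LoopRun R r` relates the states before and after a loop on the register `r` whose body acts
as `R`. -/
inductive LoopRun (R : Multiset ℕ → Multiset ℕ → Prop) (r : ℕ) :
    Multiset ℕ → Multiset ℕ → Prop
  | done (d : Multiset ℕ) : r ∉ d → LoopRun R r d d
  | step (d e d' : Multiset ℕ) : R d e → LoopRun R r e d' → LoopRun R r (r ::ₘ d) d'

namespace Prog

/-- Big-step semantics.  A state is a multiset of register names; the register `r` holds the
multiplicity of `r`. -/
def Run : Prog → Multiset ℕ → Multiset ℕ → Prop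
  | skip => fun d d' => d' = d
  | inc r => fun d d' => d' = r ::ₘ d
  | seq p q => fun d d' => ∃ e, p.Run d e ∧ q.Run e d'
  | loop r p => LoopRun p.Run r

/-- All registers named in the program are below `N`. -/
def Bounded (N : ℕ) : Prog → Prop
  | skip => True
  | inc r => r < N
  | seq p q => p.Bounded N ∧ q.Bounded N
  | loop r p => r < N ∧ p.Bounded N

theorem Bounded.mono {N N' : ℕ} (h : N ≤ N') {p : Prog} (hp : p.Bounded N) : p.Bounded N' := by
  induction p with
  | skip => trivial
  | inc r => exact lt_of_lt_of_le hp h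
  | seq p q ihp ihq => exact ⟨ihp hp.1, ihq hp.2⟩
  | loop r p ih => exact ⟨lt_of_lt_of_le hp.1 h, ih hp.2⟩

theorem exists_bounded (p : Prog) : ∃ N, p.Bounded N := by
  induction p with
  | skip => exact ⟨0, trivial⟩
  | inc r => exact ⟨r + 1, Nat.lt_succ_self r⟩
  | seq p q ihp ihq =>
    obtain ⟨N, hN⟩ := ihp
    obtain ⟨N', hN'⟩ := ihq
    exact ⟨max N N', hN.mono (le_max_left _ _), hN'.mono (le_max_right _ _)⟩
  | loop r p ih =>
    obtain ⟨N, hN⟩ := ih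
    exact ⟨max N (r + 1), lt_of_lt_of_le (Nat.lt_succ_self r) (le_max_right _ _),
      hN.mono (le_max_left _ _)⟩

theorem Run.lt_of_mem {N : ℕ} {p : Prog} (hp : p.Bounded N) {d d' : Multiset ℕ}
    (h : p.Run d d') (hd : ∀ s ∈ d, s < N) : ∀ s ∈ d', s < N := by
  induction p generalizing d d' with
  | skip => cases h; exact hd
  | inc r =>
    cases h
    intro s hs
    rcases Multiset.mem_cons.1 hs with rfl | hs
    exacts [hp, hd s hs]
  | seq p q ihp ihq =>
    obtain ⟨e, h₁, h₂⟩ := h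
    exact ihq hp.2 h₂ (ihp hp.1 h₁ hd)
  | loop r p ih =>
    change LoopRun p.Run r d d' at h
    induction h with
    | done d _ => exact hd
    | step d e d' h₁ _ ih' => exact ih' (ih hp.2 h₁ fun s hs => hd s (Multiset.mem_cons_of_mem hs))

theorem Run.unique {p : Prog} {d d₁ d₂ : Multiset ℕ} (h₁ : p.Run d d₁) (h₂ : p.Run d d₂) :
    d₁ = d₂ := by
  induction p generalizing d d₁ d₂ with
  | skip => exact Eq.trans h₁ (Eq.symm h₂)
  | inc r => exact Eq.trans h₁ (Eq.symm h₂)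
  | seq p q ihp ihq =>
    obtain ⟨e₁, h₁, h₁'⟩ := h₁
    obtain ⟨e₂, h₂, h₂'⟩ := h₂
    cases ihp h₁ h₂
    exact ihq h₁' h₂'
  | loop r p ih =>
    change LoopRun p.Run r d d₁ at h₁
    change LoopRun p.Run r d d₂ at h₂
    induction h₁ with
    | done d hr =>
      cases h₂ with
      | done => rfl
      | step => simp at hr
    | step d e d' h₁ _ ih' =>
      generalize hc : r ::ₘ d = c at h₂
      cases h₂ with
      | done _ hr => simp [← hc] at hr
      | step d e' _ h₂ h₂' =>
        cases (Multiset.cons_inj_right r).1 hc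
        cases ih h₁ h₂
        exact ih' h₂'

/-- The invariant rule for a loop that is entered `k` times. -/
theorem run_loop {p : Prog} {r : ℕ} (k : ℕ) (S : ℕ → Multiset ℕ)
    (hS : ∀ i < k, ∀ m, p.Run (S i + .replicate m r) (S (i + 1) + .replicate m r))
    (hr : r ∉ S k) : (loop r p).Run (S 0 + .replicate k r) (S k) := by
  induction k generalizing S with
  | zero =>
    rw [Multiset.replicate_zero, add_zero]
    exact LoopRun.done (S 0) hr
  | succ k ih =>
    rw [Multiset.replicate_succ, Multiset.add_cons]
    exact .step _ _ _ (hS 0 (Nat.succ_pos k) k)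
      (ih (fun i => S (i + 1)) (fun i hi => hS (i + 1) (Nat.succ_lt_succ hi)) hr)

/-- Empty the register `r` into the register `t`. -/
def move (r t : ℕ) : Prog := loop r (inc t)

theorem run_move {r t : ℕ} (h : r ≠ t) {d : Multiset ℕ} (hr : r ∉ d) (k : ℕ) :
    (move r t).Run (d + .replicate k r) (d + .replicate k t) := by
  have := run_loop (p := inc t) (r := r) k (fun i => d + .replicate i t)
    (fun i _ m => by simp [Run, Multiset.replicate_succ]) (by
      simp [hr, Multiset.mem_replicate, h])
  rwa [Multiset.replicate_zero, add_zero] at this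

/-- Empty the register `r`. -/
def clear (r : ℕ) : Prog := loop r skip

theorem run_clear {r : ℕ} {d : Multiset ℕ} (hr : r ∉ d) (k : ℕ) :
    (clear r).Run (d + .replicate k r) d :=
  run_loop (p := skip) (r := r) k (fun _ => d) (fun _ _ _ => rfl) hr

/-- Add the register `r` to the register `o`, using the register `t` to restore `r`. -/
def copy (r o t : ℕ) : Prog := seq (loop r (seq (inc o) (inc t))) (move t r)

theorem run_copy {r o t : ℕ} (hro : r ≠ o) (hrt : r ≠ t) (hot : o ≠ t) {d : Multiset ℕ}
    (ht : t ∉ d) : (copy r o t).Run d (d + .replicate (d.count r) o) := by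
  obtain ⟨e, he, hre⟩ : ∃ e, d = e + .replicate (d.count r) r ∧ r ∉ e := by
    refine ⟨d.filter (· ≠ r), ?_, by simp⟩
    rw [← Multiset.filter_eq' d r, add_comm, Multiset.filter_add_not]
  generalize d.count r = k at he
  subst he
  have hte : t ∉ e := fun h => ht (Multiset.mem_add.2 (.inl h))
  refine ⟨(e + .replicate k o) + .replicate k t, ?_, ?_⟩
  · have := run_loop (p := seq (inc o) (inc t)) (r := r) k
      (fun i => (e + .replicate i o) + .replicate i t)
      (fun i _ m => by
        refine ⟨_, rfl, ?_⟩
        simp only [Run, Multiset.replicate_succ, Multiset.add_cons, Multiset.cons_add]) (by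
        simp [hre, Multiset.mem_replicate, hro, hrt])
    simpa using this
  · have := run_move (r := t) (t := r) hrt.symm (d := e + .replicate k o)
      (by simp [hte, Multiset.mem_replicate, hot.symm]) k
    rwa [add_right_comm e (.replicate k r)]

theorem exists_clear_range (b k : ℕ) : ∃ p : Prog, ∀ d : Multiset ℕ, (∀ s ∈ d, s < b) →
    ∀ v : ℕ → ℕ, p.Run (d + ∑ i ∈ Finset.range k, .replicate (v i) (b + i)) d := by
  induction k with
  | zero => exact ⟨skip, fun d _ v => by simp [Run]⟩
  | succ k ih =>
    obtain ⟨p, hp⟩ := ih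
    refine ⟨seq (clear (b + k)) p, fun d hd v => ⟨_, ?_, hp d hd v⟩⟩
    rw [Finset.sum_range_succ, ← add_assoc]
    refine run_clear (fun h => ?_) _
    rcases Multiset.mem_add.1 h with h | h
    · exact absurd (hd _ h) (by omega)
    · obtain ⟨i, hi, h⟩ := Multiset.mem_sum.1 h
      have := Multiset.eq_of_mem_replicate h
      have := Finset.mem_range.1 hi
      omega

/-- Programs that store values depending only on the registers below `b` in the registers
`b, b + 1, …` can be run one after the other. -/
theorem exists_store_range (b n : ℕ) (v : Multiset ℕ → ℕ → ℕ)
    (h : ∀ i < n, ∃ p : Prog, ∀ d : Multiset ℕ, (∀ s ∈ d, s < b) →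
      ∀ e : Multiset ℕ, (∀ s ∈ e, b ≤ s ∧ s < b + n) →
        p.Run (d + e) (d + e + .replicate (v d i) (b + i))) (k : ℕ) (hk : k ≤ n) :
    ∃ p : Prog, ∀ d : Multiset ℕ, (∀ s ∈ d, s < b) →
      p.Run d (d + ∑ i ∈ Finset.range k, .replicate (v d i) (b + i)) := by
  induction k with
  | zero => exact ⟨skip, fun d _ => by simp [Run]⟩
  | succ k ih =>
    obtain ⟨p, hp⟩ := ih (Nat.le_of_succ_le hk)
    obtain ⟨q, hq⟩ := h k hk
    refine ⟨seq p q, fun d hd => ⟨_, hp d hd, ?_⟩⟩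
    rw [Finset.sum_range_succ, ← add_assoc]
    refine hq d hd _ fun s hs => ?_
    obtain ⟨i, hi, hs⟩ := Multiset.mem_sum.1 hs
    have := Multiset.eq_of_mem_replicate hs
    have := Finset.mem_range.1 hi
    omega

end Prog

/-- `f` is computed by loop programs: for any choice of input registers and of a different output
register below `b`, some program adds the value of `f` to the output and leaves all other registers
unchanged, provided the registers from `b` on, which serve as scratch space, are empty. -/
def Computes {n : ℕ} (f : List.Vector ℕ n → ℕ) : Prop :=
  ∀ (inp : Fin n → ℕ) (o b : ℕ), (∀ i, inp i < b) → o < b → (∀ i, inp i ≠ o) →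
    ∃ p : Prog, ∀ d : Multiset ℕ, (∀ s ∈ d, s < b) →
      p.Run d (d + .replicate (f (.ofFn fun i => d.count (inp i))) o)

open Prog

theorem Computes.comp {m n : ℕ} {f : List.Vector ℕ n → ℕ} {g : Fin n → List.Vector ℕ m → ℕ}
    (hf : Computes f) (hg : ∀ i, Computes (g i)) :
    Computes fun a => f (.ofFn fun i => g i a) := by
  intro inp o b hib hob hio
  let v : Multiset ℕ → ℕ → ℕ := fun d i =>
    if h : i < n then g ⟨i, h⟩ (.ofFn fun j => d.count (inp j)) else 0
  obtain ⟨p, hp⟩ := exists_store_range b n v (fun i hi => by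
    obtain ⟨p, hp⟩ := hg ⟨i, hi⟩ inp (b + i) (b + n) (fun j => (hib j).trans_le (by omega))
      (by omega) (fun j => by have := hib j; omega)
    refine ⟨p, fun d hd e he => ?_⟩
    have hcount : ∀ j, (d + e).count (inp j) = d.count (inp j) := fun j => by
      rw [Multiset.count_add, Multiset.count_eq_zero_of_notMem (s := e), add_zero]
      intro h
      have := he _ h
      have := hib j
      omega
    have := hp (d + e) fun s hs => by
      rcases Multiset.mem_add.1 hs with hs | hs
      · have := hd s hs; omega
      · exact (he s hs).2
    simpa only [v, hi, hcount, dif_pos] using this) n le_rfl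
  obtain ⟨q, hq⟩ := hf (fun i => b + i) o (b + n) (fun i => by omega) (by omega)
    (fun i => by omega)
  obtain ⟨c, hc⟩ := exists_clear_range b n
  refine ⟨seq p (seq q c), fun d hd => ⟨_, hp d hd, _, hq _ ?_, ?_⟩⟩
  · intro s hs
    rcases Multiset.mem_add.1 hs with hs | hs
    · have := hd s hs; omega
    · obtain ⟨i, hi, hs⟩ := Multiset.mem_sum.1 hs
      have := Multiset.eq_of_mem_replicate hs
      have := Finset.mem_range.1 hi
      omega
  · have hcount : ∀ i : Fin n, (d + ∑ i ∈ Finset.range n, Multiset.replicate (v d i) (b + i)).count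
        (b + i) = g i (.ofFn fun j => d.count (inp j)) := fun i => by
      rw [Multiset.count_add, Multiset.count_eq_zero_of_notMem (fun h => by
        have := hd _ h; omega), zero_add, Multiset.count_sum']
      simp only [Multiset.count_replicate]
      rw [Finset.sum_eq_single i.1 (fun j _ hj => if_neg (by omega))
        (fun h => absurd (Finset.mem_range.2 i.2) h)]
      simp [v]
    simp only [hcount]
    rw [add_right_comm]
    refine hc _ (fun s hs => ?_) _
    rcases Multiset.mem_add.1 hs with hs | hs
    · exact hd s hs
    · rwa [Multiset.eq_of_mem_replicate hs]

theorem Computes.prec {n : ℕ} {f : List.Vector ℕ n → ℕ} {g : List.Vector ℕ (n + 2) → ℕ}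
    (hf : Computes f) (hg : Computes g) :
    Computes fun v : List.Vector ℕ (n + 1) =>
      v.head.rec (f v.tail) fun y IH => g (y ::ᵥ IH ::ᵥ v.tail) := by
  intro inp o b hib hob hio
  -- The scratch registers: `b` accumulates, `b + 1` counts up, `b + 2` receives the value of `g`,
  -- and `b + 3` counts down.
  obtain ⟨pf, hpf⟩ := hf (fun i => inp i.succ) b (b + 4) (fun i => (hib _).trans (by omega))
    (by omega) (fun i => (hib _).ne)
  obtain ⟨pg, hpg⟩ := hg (Fin.cons (b + 1) (Fin.cons b fun i => inp i.succ)) (b + 2) (b + 4)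
    (fun i => by
      refine Fin.cases ?_ (fun i => Fin.cases ?_ (fun i => ?_) i) i
      · simp
      · simp
      · simpa using (hib _).trans (by omega))
    (by omega)
    (fun i => by
      refine Fin.cases ?_ (fun i => Fin.cases ?_ (fun i => ?_) i) i
      · simp
      · simp
      · simpa using ((hib i.succ).trans (by omega)).ne)
  refine ⟨seq (copy (inp 0) (b + 3) (b + 4)) (seq pf (seq
    (loop (b + 3) (seq pg (seq (clear b) (seq (move (b + 2) b) (inc (b + 1))))))
    (seq (move b o) (clear (b + 1))))), fun d hd => ?_⟩
  have hdn : ∀ s, b ≤ s → s ∉ d := fun s hs h => absurd (hd s h) (by omega)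
  have hd0 : ∀ s, b ≤ s → d.count s = 0 := fun s hs => Multiset.count_eq_zero_of_notMem (hdn s hs)
  set m := d.count (inp 0) with hm
  set w : List.Vector ℕ n := .ofFn fun i => d.count (inp i.succ) with hw
  let F : ℕ → ℕ := fun k => k.rec (f w) fun y IH => g (y ::ᵥ IH ::ᵥ w)
  let S : ℕ → Multiset ℕ := fun i => d + .replicate i (b + 1) + .replicate (F i) b
  have hne : ∀ (j : Fin (n + 1)) (k : ℕ), b + k ≠ inp j := fun j k => by have := hib j; omega
  have hne' : ∀ j : Fin (n + 1), b ≠ inp j := fun j => by have := hib j; omega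
  have hvec : (List.Vector.ofFn fun i => d.count (inp i)) = m ::ᵥ w := rfl
  refine ⟨_, run_copy (hne 0 3).symm (hne 0 4).symm (by omega) (hdn _ (by omega)), _,
    hpf _ ?_, S m, ?_, d + .replicate m (b + 1) + .replicate (F m) o, ?_, ?_⟩
  · intro s hs
    rcases Multiset.mem_add.1 hs with hs | hs
    · have := hd s hs; omega
    · have := Multiset.eq_of_mem_replicate hs; omega
  · have := run_loop (p := seq pg (seq (clear b) (seq (move (b + 2) b) (inc (b + 1)))))
      (r := b + 3) m S (fun i _ k => ?_) ?_
    · convert this using 1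
      simp only [S, F, Multiset.replicate_zero, add_zero]
      rw [add_right_comm]
      simp only [Multiset.count_add, Multiset.count_replicate, hne, if_false, add_zero]
      rfl
    · have hin : (List.Vector.ofFn fun j => (S i + .replicate k (b + 3)).count
          ((Fin.cons (b + 1) (Fin.cons b fun i => inp i.succ) : Fin (n + 2) → ℕ) j)) =
          i ::ᵥ F i ::ᵥ w := by
        simp only [List.Vector.ofFn, Fin.cons_zero, Fin.cons_succ, S, Multiset.count_add,
          Multiset.count_replicate, hne, hne', hd0 b le_rfl, hd0 (b + 1) (by omega), hw]
        simp
      have h₁ := hpg (S i + .replicate k (b + 3)) (by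
        intro s hs
        simp only [S, Multiset.mem_add, Multiset.mem_replicate] at hs
        rcases hs with ((hs | hs) | hs) | hs
        · have := hd s hs; omega
        all_goals omega)
      rw [hin] at h₁
      change pg.Run _ (_ + .replicate (F (i + 1)) (b + 2)) at h₁
      refine ⟨_, h₁, d + .replicate i (b + 1) + .replicate k (b + 3) +
        .replicate (F (i + 1)) (b + 2), ?_, d + .replicate i (b + 1) + .replicate k (b + 3) +
        .replicate (F (i + 1)) b, run_move (by omega) ?_ _, ?_⟩
      · have := run_clear (r := b) (d := d + .replicate i (b + 1) + .replicate k (b + 3) +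
          .replicate (F (i + 1)) (b + 2)) (by
            simp [Multiset.mem_replicate, hdn b le_rfl]) (F i)
        convert this using 1
        simp only [S]
        abel
      · simp [Multiset.mem_replicate, hdn (b + 2)]
      · simp only [S, Run, Multiset.replicate_succ, Multiset.add_cons, Multiset.cons_add]
        rw [add_right_comm]
    · simp [S, Multiset.mem_replicate, hdn (b + 3)]
  · exact run_move hob.ne' (by simp [Multiset.mem_replicate, hdn b le_rfl]) _
  · rw [hvec, add_right_comm]
    exact run_clear (by
      simp [Multiset.mem_replicate, hdn (b + 1), (hob.trans (Nat.lt_succ_self b)).ne']) _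

theorem computes_of_primrec {n : ℕ} {f : List.Vector ℕ n → ℕ} (hf : Nat.Primrec' f) :
    Computes f := by
  induction hf with
  | zero => exact fun _ _ _ _ _ _ => ⟨skip, fun d _ => by simp [Run]⟩
  | succ =>
    intro inp o b hib hob hio
    refine ⟨seq (copy (inp 0) o b) (inc o), fun d hd =>
      ⟨_, run_copy (hio 0) (hib 0).ne hob.ne fun h => absurd (hd b h) (lt_irrefl b), ?_⟩⟩
    change _ + Multiset.replicate (d.count (inp 0) + 1) o = _
    simp [Multiset.replicate_succ]
  | get i =>
    intro inp o b hib hob hio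
    refine ⟨copy (inp i) o b, fun d hd => ?_⟩
    simp only [List.Vector.get_ofFn]
    exact run_copy (hio i) (hib i).ne hob.ne fun h => absurd (hd b h) (lt_irrefl b)
  | comp g _ _ ihf ihg => exact ihf.comp ihg
  | prec _ _ ihf ihg => exact ihf.prec ihg

/-- Every computably enumerable set is the domain of a loop program reading its input from the
register `0`. -/
theorem exists_prog_of_rePred {P : ℕ → Prop} (hP : REPred P) :
    ∃ p : Prog, ∀ n, P n ↔ ∃ d', p.Run (.replicate n 0) d' := by
  obtain ⟨c, hc⟩ := Nat.Partrec.Code.exists_code.1 hP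
  -- The program searches for a number of steps within which the code `c` halts.
  let h : ℕ → ℕ → ℕ := fun n k => if (Nat.Partrec.Code.evaln k c n).isSome then 0 else 1
  have hprim : Primrec₂ h := Primrec.ite
    (Primrec.eq.comp (Primrec.option_isSome.comp (Nat.Partrec.Code.primrec_evaln.comp
      ((Primrec.snd.pair (Primrec.const c)).pair Primrec.fst))) (Primrec.const true))
    (Primrec.const 0) (Primrec.const 1)
  have hPh : ∀ n, P n ↔ ∃ k, h n k = 0 := fun n => by
    have h₁ : P n ↔ (c.eval n).Dom := by
      rw [hc]; simp [Part.assert]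
    rw [h₁, Part.dom_iff_mem]
    simp only [Nat.Partrec.Code.evaln_complete, h]
    rw [exists_comm]
    simp [Option.isSome_iff_exists]
  obtain ⟨pg, hpg⟩ := computes_of_primrec (Nat.Primrec'.prim_iff₂.2 hprim) ![0, 1] 3 4
    (by simp [Fin.forall_fin_two]) (by simp) (by simp [Fin.forall_fin_two])
  let body : Prog := seq pg (seq (inc 1) (move 3 2))
  let T : ℕ → ℕ → Multiset ℕ := fun n k => .replicate n 0 + .replicate k 1
  have hbody : ∀ n k, body.Run (T n k) (T n (k + 1) + .replicate (h n k) 2) := fun n k => by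
    have h₁ := hpg (T n k) (by
      intro s hs
      simp only [T, Multiset.mem_add, Multiset.mem_replicate] at hs
      omega)
    have h₂ : (List.Vector.ofFn fun i => (T n k).count ((![0, 1] : Fin 2 → ℕ) i)) =
        n ::ᵥ k ::ᵥ .nil := by
      simp [List.Vector.ofFn, T, Multiset.count_replicate]
    rw [h₂] at h₁
    refine ⟨_, h₁, T n (k + 1) + .replicate (h n k) 3, ?_, run_move (by omega) ?_ _⟩
    · simp [Run, T, Multiset.replicate_succ]
    · simp [T, Multiset.mem_replicate]
  refine ⟨seq (inc 2) (loop 2 body), fun n => (hPh n).trans ⟨?_, ?_⟩⟩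
  · rintro ⟨k, hk⟩
    have key : ∀ j i, h n (i + j) = 0 → ∃ d', (loop 2 body).Run (2 ::ₘ T n i) d' := by
      intro j
      induction j with
      | zero =>
        intro i hi
        have := hbody n i
        rw [add_zero] at hi
        rw [hi] at this
        exact ⟨_, .step _ _ _ this (.done _ (by simp [T, Multiset.mem_replicate]))⟩
      | succ j ih =>
        intro i hi
        have hb := hbody n i
        by_cases h0 : h n i = 0
        · rw [h0] at hb
          exact ⟨_, .step _ _ _ hb (.done _ (by simp [T, Multiset.mem_replicate]))⟩
        · have h1 : h n i = 1 := by
            simp only [h] at h0 ⊢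
            split_ifs at h0 ⊢ <;> simp_all
          obtain ⟨d', hd'⟩ := ih (i + 1) (by rwa [add_right_comm, add_assoc])
          refine ⟨d', .step _ _ _ hb ?_⟩
          rw [h1, add_comm]
          exact hd'
    obtain ⟨d', hd'⟩ := key k 0 (by simpa using hk)
    exact ⟨d', _, rfl, by simpa [T] using hd'⟩
  · have key : ∀ e d', LoopRun body.Run 2 e d' → ∀ i, e = 2 ::ₘ T n i → ∃ k, h n k = 0 := by
      intro e d' h'
      induction h' with
      | done d hd => rintro i rfl; simp at hd
      | step d e d' h₁ _ ih =>
        intro i he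
        cases (Multiset.cons_inj_right 2).1 he
        have hb := h₁.unique (hbody n i)
        by_cases h0 : h n i = 0
        · exact ⟨i, h0⟩
        · have h1 : h n i = 1 := by
            simp only [h] at h0 ⊢
            split_ifs at h0 ⊢ <;> simp_all
          refine ih (i + 1) ?_
          rw [hb, h1, add_comm]
          rfl
    rintro ⟨d', e, he, h'⟩
    exact key e d' h' 0 (by rw [show e = 2 ::ₘ .replicate n 0 from he]; simp [T])

end MuMALL

/-! ### Substitution -/

namespace MuMALL

namespace Fml

variable {ι : Type u} {κ : Type v}

theorem upRen_comp (ρ ρ' : ℕ → ℕ) : upRen ρ' ∘ upRen ρ = upRen (ρ' ∘ ρ) := by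
  funext n; cases n <;> rfl

theorem rename_rename (ρ ρ' : ℕ → ℕ) (A : Fml ι) :
    (A.rename ρ).rename ρ' = A.rename (ρ' ∘ ρ) := by
  induction A generalizing ρ ρ' <;> simp_all [rename, upRen_comp]

theorem upSub_comp_upRen (ρ : ℕ → ℕ) (σ : ℕ → Fml ι) :
    upSub σ ∘ upRen ρ = upSub (σ ∘ ρ) := by
  funext n; cases n <;> rfl

theorem subst_rename (ρ : ℕ → ℕ) (σ : ℕ → Fml ι) (A : Fml ι) :
    (A.rename ρ).subst σ = A.subst (σ ∘ ρ) := by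
  induction A generalizing ρ σ <;> simp_all [rename, subst, upSub_comp_upRen]

theorem upSub_rename (σ : ℕ → Fml ι) (ρ : ℕ → ℕ) :
    (fun n => (upSub σ n).rename (upRen ρ)) = upSub fun n => (σ n).rename ρ := by
  funext n
  cases n with
  | zero => rfl
  | succ n => simp only [upSub, rename_rename]; rfl

theorem rename_subst (σ : ℕ → Fml ι) (ρ : ℕ → ℕ) (A : Fml ι) :
    (A.subst σ).rename ρ = A.subst fun n => (σ n).rename ρ := by
  induction A generalizing ρ σ <;> simp_all [rename, subst, upSub_rename]

theorem subst_var (A : Fml ι) : A.subst var = A := by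
  have h : upSub (var : ℕ → Fml ι) = var := by funext n; cases n <;> rfl
  induction A <;> simp_all [subst]

theorem subst_upSub_rename (σ : ℕ → Fml ι) (A : Fml ι) :
    (A.rename Nat.succ).subst (upSub σ) = (A.subst σ).rename Nat.succ := by
  rw [subst_rename, rename_subst]; rfl

theorem inst_rename (A B : Fml ι) : (A.rename Nat.succ).inst B = A := by
  rw [inst, subst_rename]; exact subst_var A

theorem mapAnn_rename (f : ι → κ) (ρ : ℕ → ℕ) (A : Fml ι) :
    (A.rename ρ).mapAnn f = (A.mapAnn f).rename ρ := by
  induction A generalizing ρ <;> simp_all [rename, mapAnn]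

/-! ### Loop programs as formulas -/

/-- The body of `drain`. -/
def drainBody (r : ℕ) : ℕ → Fml ι
  | 0 => one
  | N + 1 => if N = r then drainBody r N else plus (tensor (nprop N) (var 0)) (drainBody r N)

/-- The fixed point `μ x (1 ⊕ ⨁ (¬s ⊗ x))`, where `s` ranges over the registers `s < N` different
from `r`: it consumes all registers below `N` except `r`. -/
def drain (i : ι) (r N : ℕ) : Fml ι := mu i (drainBody r N)

/-- The formula that runs a program, in a context of propositional symbols that represent the state,
and then continues as the formula `K`.  A loop on `r` is a fixed point offering the choice between
consuming `r` and running the body once more, or continuing with `K`; the additive conjunction with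
`drain` makes the second possible only if `r` is absent. -/
def run (i : ι) (N : ℕ) : Prog → Fml ι → Fml ι
  | .skip, K => K
  | .inc r, K => par (prop r) K
  | .seq p q, K => run i N p (run i N q K)
  | .loop r p, K => mu i (plus (tensor (nprop r) (run i N p (var 0)))
      (.with (drain i r N) (K.rename Nat.succ)))

theorem subst_drain (i : ι) (r N : ℕ) (σ : ℕ → Fml ι) : (drain i r N).subst σ = drain i r N := by
  have h : (drainBody r N).subst (upSub σ) = drainBody r N := by
    induction N with
    | zero => rfl
    | succ N ih => simp only [drainBody]; split_ifs <;> simp [subst, ih, upSub]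
  simp [drain, subst, h]

theorem subst_run (i : ι) (N : ℕ) (p : Prog) (K : Fml ι) (σ : ℕ → Fml ι) :
    (run i N p K).subst σ = run i N p (K.subst σ) := by
  induction p generalizing K σ with
  | skip => rfl
  | inc r => rfl
  | seq p q ihp ihq => simp [run, ihp, ihq]
  | loop r p ih => simp [run, subst, ih, subst_drain, subst_upSub_rename, upSub]

theorem mapAnn_drain (f : ι → κ) (i : ι) (r N : ℕ) :
    (drain i r N).mapAnn f = drain (f i) r N := by
  have h : (drainBody r N : Fml ι).mapAnn f = drainBody r N := by
    induction N with
    | zero => rfl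
    | succ N ih => simp only [drainBody]; split_ifs <;> simp [mapAnn, ih]
  simp [drain, mapAnn, h]

theorem mapAnn_run (f : ι → κ) (i : ι) (N : ℕ) (p : Prog) (K : Fml ι) :
    (run i N p K).mapAnn f = run (f i) N p (K.mapAnn f) := by
  induction p generalizing K with
  | skip => rfl
  | inc r => rfl
  | seq p q ihp ihq => simp [run, ihp, ihq]
  | loop r p ih => simp [run, mapAnn, ih, mapAnn_drain, mapAnn_rename]

end Fml

/-! ### Halting computations give derivations -/

open Fml

variable {α : Ordinal.{u}}

theorem provable_consume {s : ℕ} {X : OrdFml α} {Γ : Multiset (OrdFml α)}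
    (h : Provable α (X ::ₘ Γ)) : Provable α (tensor (nprop s) X ::ₘ prop s ::ₘ Γ) := by
  have h₁ : Provable α (nprop s ::ₘ {prop s}) := by
    have := Provable.id (α := α) (nprop s)
    exact this
  have := Provable.tensor {prop s} Γ (nprop s) X h₁ h
  rwa [Multiset.singleton_add] at this

theorem provable_drainBody_consume {r N s : ℕ} (hs : s < N) (hr : s ≠ r) {X : OrdFml α}
    {Γ : Multiset (OrdFml α)} (h : Provable α (X ::ₘ Γ)) :
    Provable α ((drainBody r N).inst X ::ₘ prop s ::ₘ Γ) := by
  induction N with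
  | zero => omega
  | succ N ih =>
    simp only [drainBody]
    split_ifs with hN
    · exact ih (by omega)
    · by_cases hsN : s = N
      · subst hsN
        exact .plusLeft _ _ _ (provable_consume h)
      · exact .plusRight _ _ _ (ih (by omega))

theorem provable_drainBody_one {r N : ℕ} (X : OrdFml α) :
    Provable α {(drainBody r N).inst X} := by
  induction N with
  | zero => exact .one
  | succ N ih =>
    simp only [drainBody]
    split_ifs with hN
    · exact ih
    · exact .plusRight 0 _ _ ih

/-- The natural number `n` as an annotation. -/
def natAnn (hα : Ordinal.omega0 ≤ α) (n : ℕ) : Set.Iic α :=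
  ⟨n, (Ordinal.natCast_lt_omega0 n).le.trans hα⟩

theorem provable_drain (hα : Ordinal.omega0 ≤ α) {r N : ℕ} (d : Multiset ℕ)
    (hd : ∀ s ∈ d, s < N) (hr : r ∉ d) (β : Set.Iic α) (hβ : (d.card : Ordinal) < β.1) :
    Provable α (drain β r N ::ₘ d.map prop) := by
  induction d using Multiset.induction_on generalizing β with
  | empty =>
    exact .mu 0 β (natAnn hα 0) _ (by simpa [natAnn, ← Subtype.coe_lt_coe] using hβ)
      (provable_drainBody_one _)
  | cons s d ih =>
    rw [Multiset.map_cons]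
    refine .mu _ β (natAnn hα (d.card + 1)) _ ?_ (provable_drainBody_consume
      (hd s (Multiset.mem_cons_self s d)) (fun h => hr (Multiset.mem_cons.2 (.inl h.symm)))
      (ih (fun t ht => hd t (Multiset.mem_cons_of_mem ht))
        (fun h => hr (Multiset.mem_cons_of_mem h)) _ ?_))
    · simpa [natAnn, ← Subtype.coe_lt_coe] using hβ
    · simp only [natAnn]
      exact_mod_cast Nat.lt_succ_self _

/-- A run of a program is a derivation: a loop entered `n` times needs `n + 1` unfoldings of its
fixed point, so that every annotation above `n` will do. -/
theorem provable_run (hα : Ordinal.omega0 ≤ α) {N : ℕ} {p : Prog} (hp : p.Bounded N)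
    {d d' : Multiset ℕ} (hd : ∀ s ∈ d, s < N) (h : p.Run d d') (K : OrdFml α)
    (hK : Provable α (K ::ₘ d'.map prop)) :
    Provable α (run ⟨α, le_refl α⟩ N p K ::ₘ d.map prop) := by
  induction p generalizing d d' K with
  | skip => cases h; exact hK
  | inc r =>
    cases h
    refine .par _ _ _ ?_
    rwa [Multiset.cons_swap, ← Multiset.map_cons]
  | seq p q ihp ihq =>
    obtain ⟨e, h₁, h₂⟩ := h
    exact ihp hp.1 hd h₁ _ (ihq hp.2 (h₁.lt_of_mem hp.1 hd) h₂ K hK)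
  | loop r p ih =>
    set B : OrdFml α := plus (tensor (nprop r) (run ⟨α, le_refl α⟩ N p (var 0)))
      (.with (drain ⟨α, le_refl α⟩ r N) (K.rename Nat.succ)) with hB
    have hinst : ∀ X, B.inst X = plus (tensor (nprop r) (run ⟨α, le_refl α⟩ N p X))
        (.with (drain ⟨α, le_refl α⟩ r N) K) := fun X => by
      have := inst_rename K X
      rw [inst] at this
      simp [hB, inst, subst, subst_run, subst_drain, this, single]
    have key : ∃ n : ℕ, ∀ β : Set.Iic α, (n : Ordinal) < β.1 →
        Provable α (mu β B ::ₘ d.map prop) := by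
      change LoopRun p.Run r d d' at h
      induction h with
      | done d hr =>
        refine ⟨0, fun β hβ => .mu _ β (natAnn hα 0) _ hβ ?_⟩
        rw [hinst]
        exact .plusRight _ _ _ (.with _ _ _ (provable_drain hα d hd hr _
          ((Ordinal.natCast_lt_omega0 _).trans_le hα)) hK)
      | step d e d' h₁ _ ih' =>
        have hd₁ : ∀ s ∈ d, s < N := fun s hs => hd s (Multiset.mem_cons_of_mem hs)
        obtain ⟨n, hn⟩ := ih' (h₁.lt_of_mem hp.2 hd₁) hK
        refine ⟨n + 1, fun β hβ => .mu _ β (natAnn hα (n + 1)) _ hβ ?_⟩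
        rw [hinst, Multiset.map_cons]
        refine .plusLeft _ _ _ (provable_consume (ih hp.2 hd₁ h₁ _ (hn _ ?_)))
        simp only [natAnn]
        exact_mod_cast Nat.lt_succ_self n
    obtain ⟨n, hn⟩ := key
    exact hn _ ((Ordinal.natCast_lt_omega0 n).trans_le hα)

end MuMALL

/-! ### Phase semantics -/

namespace MuMALL

open scoped Pointwise

section Phase

variable {M : Type v} [AddCommMonoid M]

/-- The orthogonal of `X` with respect to the pole `P`. -/
def orth (P X : Set M) : Set M := {m | ∀ x ∈ X, x + m ∈ P}

variable {P : Set M}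

theorem orth_anti {X Y : Set M} (h : X ⊆ Y) : orth P Y ⊆ orth P X :=
  fun _ hm x hx => hm x (h hx)

theorem subset_orth_orth (X : Set M) : X ⊆ orth P (orth P X) :=
  fun x hx m hm => by rw [add_comm]; exact hm x hx

theorem orth_orth_orth (X : Set M) : orth P (orth P (orth P X)) = orth P X :=
  (orth_anti (subset_orth_orth X)).antisymm (subset_orth_orth _)

theorem orth_union (X Y : Set M) : orth P (X ∪ Y) = orth P X ∩ orth P Y := by
  ext m
  exact ⟨fun h => ⟨fun x hx => h x (.inl hx), fun x hx => h x (.inr hx)⟩,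
    fun h x hx => hx.elim (h.1 x) (h.2 x)⟩

theorem orth_iUnion {κ : Sort*} (X : κ → Set M) : orth P (⋃ i, X i) = ⋂ i, orth P (X i) := by
  ext m
  simp only [orth, Set.mem_iUnion, Set.mem_iInter, Set.mem_ofPred_eq]
  exact ⟨fun h i x hx => h x ⟨i, hx⟩, fun h x ⟨i, hx⟩ => h i x hx⟩

theorem add_subset_iff {X Y : Set M} : X + Y ⊆ P ↔ Y ⊆ orth P X := by
  rw [Set.add_subset_iff]
  exact ⟨fun h y hy x hx => h x hx y hy, fun h x hx y hy => h hy x hx⟩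

variable (P) in
/-- A fact is a set equal to its biorthogonal. -/
def IsFact (X : Set M) : Prop := orth P (orth P X) = X

theorem isFact_orth (X : Set M) : IsFact P (orth P X) := orth_orth_orth X

theorem IsFact.orth_orth_subset {X F : Set M} (hF : IsFact P F) (h : X ⊆ F) :
    orth P (orth P X) ⊆ F := by
  have := orth_anti (P := P) (orth_anti (P := P) h)
  rwa [hF] at this

theorem IsFact.inter {X Y : Set M} (hX : IsFact P X) (hY : IsFact P Y) : IsFact P (X ∩ Y) :=
  Set.Subset.antisymm (Set.subset_inter (hX.orth_orth_subset Set.inter_subset_left)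
    (hY.orth_orth_subset Set.inter_subset_right)) (subset_orth_orth _)

theorem isFact_iInter {κ : Sort*} {X : κ → Set M} (h : ∀ i, IsFact P (X i)) :
    IsFact P (⋂ i, X i) :=
  Set.Subset.antisymm (Set.subset_iInter fun i => (h i).orth_orth_subset (Set.iInter_subset _ i))
    (subset_orth_orth _)

variable (P) in
/-- The iterates of `φ` that interpret `μ^β`: each is the fact generated by the values of `φ` at the
earlier ones. -/
noncomputable def muIter (φ : Set M → Set M) (β : Ordinal.{u}) : Set M :=
  orth P (orth P (⋃ γ : Set.Iio β, φ (muIter φ γ.1)))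
termination_by β
decreasing_by exact γ.2

/-- The iterates of `φ` that interpret `ν^β`: each is the intersection of the values of `φ` at the
earlier ones. -/
noncomputable def nuIter (φ : Set M → Set M) (β : Ordinal.{u}) : Set M :=
  ⋂ γ : Set.Iio β, φ (nuIter φ γ.1)
termination_by β
decreasing_by exact γ.2

theorem isFact_muIter (φ : Set M → Set M) (β : Ordinal.{u}) : IsFact P (muIter P φ β) := by
  rw [muIter]; exact isFact_orth _

theorem isFact_nuIter {φ : Set M → Set M} (h : ∀ X, IsFact P X → IsFact P (φ X))
    (β : Ordinal.{u}) : IsFact P (nuIter φ β) := by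
  induction β using WellFoundedLT.induction with
  | ind β ih =>
    rw [nuIter]
    exact isFact_iInter fun γ => h _ (ih γ.1 γ.2)

theorem nuIter_eq_orth_muIter {φ ψ : Set M → Set M}
    (h : ∀ X, IsFact P X → ψ (orth P X) = orth P (φ X)) (β : Ordinal.{u}) :
    nuIter ψ β = orth P (muIter P φ β) := by
  induction β using WellFoundedLT.induction with
  | ind β ih =>
    rw [nuIter, muIter, orth_orth_orth, orth_iUnion]
    refine Set.iInter_congr fun γ => ?_
    rw [ih γ.1 γ.2, h _ (isFact_muIter φ _)]

theorem muIter_eq_orth_nuIter {φ ψ : Set M → Set M} (hφ : ∀ X, IsFact P X → IsFact P (φ X))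
    (h : ∀ X, IsFact P X → ψ (orth P X) = orth P (φ X)) (β : Ordinal.{u}) :
    muIter P ψ β = orth P (nuIter φ β) := by
  have : nuIter φ β = orth P (muIter P ψ β) := nuIter_eq_orth_muIter (fun X hX => by
    have := h _ (isFact_orth X)
    rw [hX] at this
    rw [this, hφ _ (isFact_orth X)]) β
  rw [this, isFact_muIter ψ β]

/-- A fact below which `φ` stays contains all iterates. -/
theorem muIter_subset {φ : Set M → Set M} {F : Set M} (hF : IsFact P F)
    (h : ∀ X, X ⊆ F → φ X ⊆ F) (β : Ordinal.{u}) : muIter P φ β ⊆ F := by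
  induction β using WellFoundedLT.induction with
  | ind β ih =>
    rw [muIter]
    exact hF.orth_orth_subset (Set.iUnion_subset fun γ => h _ (ih γ.1 γ.2))

/-- Extension of a valuation of the variables under a binder. -/
def scons (X : Set M) (ρ : ℕ → Set M) : ℕ → Set M
  | 0 => X
  | n + 1 => ρ n

variable {α : Ordinal.{u}}

variable (P) in
/-- The interpretation of formulas in the phase space with pole `P`.  The literals are given
by arbitrary sets `V p`: `¬p` denotes the biorthogonal of `V p`, and `p` its orthogonal.  Variables
are interpreted by `ρ`. -/
noncomputable def eval (V : ℕ → Set M) : OrdFml α → (ℕ → Set M) → Set M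
  | .var n, ρ => ρ n
  | .prop p, _ => orth P (V p)
  | .nprop p, _ => orth P (orth P (V p))
  | .one, _ => orth P (orth P {0})
  | .bot, _ => orth P {0}
  | .zero, _ => orth P Set.univ
  | .top, _ => Set.univ
  | .tensor A B, ρ => orth P (orth P (eval V A ρ + eval V B ρ))
  | .par A B, ρ => orth P (orth P (eval V A ρ) + orth P (eval V B ρ))
  | .plus A B, ρ => orth P (orth P (eval V A ρ ∪ eval V B ρ))
  | .with A B, ρ => eval V A ρ ∩ eval V B ρ
  | .mu β A, ρ => muIter P (fun X => eval V A (scons X ρ)) β.1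
  | .nu β A, ρ => nuIter (fun X => eval V A (scons X ρ)) β.1

variable {V : ℕ → Set M}

theorem isFact_scons {X : Set M} {ρ : ℕ → Set M} (hX : IsFact P X) (hρ : ∀ n, IsFact P (ρ n))
    (n : ℕ) : IsFact P (scons X ρ n) := by
  cases n with
  | zero => exact hX
  | succ n => exact hρ n

theorem isFact_eval (A : OrdFml α) {ρ : ℕ → Set M} (hρ : ∀ n, IsFact P (ρ n)) :
    IsFact P (eval P V A ρ) := by
  induction A generalizing ρ with
  | var n => exact hρ n
  | top => exact Set.Subset.antisymm (Set.subset_univ _) (subset_orth_orth _)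
  | mu β A _ => exact isFact_muIter _ _
  | nu β A ih => exact isFact_nuIter (fun X hX => ih (isFact_scons hX hρ)) _
  | prop | nprop | one | bot | zero | tensor | par | plus => exact isFact_orth _
  | _ A B ihA ihB => exact (ihA hρ).inter (ihB hρ)

theorem eval_neg (A : OrdFml α) {ρ : ℕ → Set M} (hρ : ∀ n, IsFact P (ρ n)) :
    eval P V A.neg (fun n => orth P (ρ n)) = orth P (eval P V A ρ) := by
  have hcons : ∀ (X : Set M) (ρ : ℕ → Set M),
      scons (orth P X) (fun n => orth P (ρ n)) = fun n => orth P (scons X ρ n) := fun X ρ => by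
    funext n; cases n <;> rfl
  induction A generalizing ρ with
  | var n => rfl
  | prop p => rfl
  | nprop p => exact (orth_orth_orth _).symm
  | one => exact (orth_orth_orth _).symm
  | bot => rfl
  | zero => exact (Set.Subset.antisymm (Set.subset_univ _) (subset_orth_orth _)).symm
  | top => rfl
  | tensor A B ihA ihB =>
    simp only [Fml.neg, eval, ihA hρ, ihB hρ]
    rw [isFact_eval A hρ, isFact_eval B hρ, orth_orth_orth]
  | par A B ihA ihB => simp only [Fml.neg, eval, ihA hρ, ihB hρ]
  | plus A B ihA ihB =>
    simp only [Fml.neg, eval, ihA hρ, ihB hρ]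
    rw [orth_orth_orth, orth_union]
  | mu β A ih =>
    exact nuIter_eq_orth_muIter (fun X hX => by rw [hcons]; exact ih (isFact_scons hX hρ)) _
  | nu β A ih =>
    exact muIter_eq_orth_nuIter (fun X hX => isFact_eval A (isFact_scons hX hρ))
      (fun X hX => by rw [hcons]; exact ih (isFact_scons hX hρ)) _
  | _ A B ihA ihB =>
    simp only [Fml.neg, eval, ihA hρ, ihB hρ]
    rw [orth_union, isFact_eval A hρ, isFact_eval B hρ]

theorem eval_rename (A : OrdFml α) (f : ℕ → ℕ) (ρ : ℕ → Set M) :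
    eval P V (A.rename f) ρ = eval P V A fun n => ρ (f n) := by
  have hcons : ∀ (X : Set M) (f : ℕ → ℕ) (ρ : ℕ → Set M),
      (fun n => scons X ρ (Fml.upRen f n)) = scons X fun n => ρ (f n) := fun X f ρ => by
    funext n; cases n <;> rfl
  induction A generalizing f ρ <;> simp_all [Fml.rename, eval]

theorem eval_subst (A : OrdFml α) (σ : ℕ → OrdFml α) (ρ : ℕ → Set M) :
    eval P V (A.subst σ) ρ = eval P V A fun n => eval P V (σ n) ρ := by
  have hcons : ∀ (X : Set M) (σ : ℕ → OrdFml α) (ρ : ℕ → Set M),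
      (fun n => eval P V (Fml.upSub σ n) (scons X ρ)) =
        scons X fun n => eval P V (σ n) ρ := fun X σ ρ => by
    funext n
    cases n with
    | zero => rfl
    | succ n => exact eval_rename _ _ _
  induction A generalizing σ ρ <;> simp_all [Fml.subst, eval]

theorem eval_inst (A B : OrdFml α) (ρ : ℕ → Set M) :
    eval P V (A.inst B) ρ = eval P V A (scons (eval P V B ρ) ρ) := by
  rw [Fml.inst, eval_subst]
  congr 1
  funext n; cases n <;> rfl

/-- A derivable sequent holds in every phase space, for variables interpreted by facts that are
their own orthogonals. -/
theorem Provable.sound {ρ : ℕ → Set M} (hρ : ∀ n, orth P (ρ n) = ρ n)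
    {Γ : Multiset (OrdFml α)} (h : Provable α Γ) :
    (Γ.map fun A => orth P (eval P V A ρ)).sum ⊆ P := by
  have hρ' : ∀ n, IsFact P (ρ n) := fun n => by rw [IsFact, hρ, hρ]
  have hneg : ∀ A : OrdFml α, eval P V A.neg ρ = orth P (eval P V A ρ) := fun A => by
    have := eval_neg (V := V) A hρ'
    simpa only [hρ] using this
  have hcons : ∀ (A : OrdFml α) (Γ : Multiset (OrdFml α)),
      ((A ::ₘ Γ).map fun A => orth P (eval P V A ρ)).sum ⊆ P ↔
        (Γ.map fun A => orth P (eval P V A ρ)).sum ⊆ eval P V A ρ := fun A Γ => by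
    rw [Multiset.map_cons, Multiset.sum_cons, add_subset_iff, isFact_eval A hρ']
  induction h with
  | id A =>
    rw [← Multiset.cons_zero A.neg, Multiset.insert_eq_cons, hcons]
    simp only [Multiset.cons_zero, Multiset.map_singleton, Multiset.sum_singleton, hneg]
    exact (isFact_eval A hρ').subset
  | cut Γ Δ A _ _ ih₁ ih₂ =>
    rw [hcons] at ih₁ ih₂
    rw [hneg] at ih₂
    rw [Multiset.map_add, Multiset.sum_add]
    exact (Set.add_subset_add_right ih₁).trans (add_subset_iff.2 ih₂)
  | one =>
    rw [← Multiset.cons_zero, hcons]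
    exact subset_orth_orth _
  | bot Γ _ ih =>
    rw [hcons]
    intro m hm x hx
    rw [Set.mem_singleton_iff.1 hx, zero_add]
    exact ih hm
  | top Γ =>
    rw [hcons]
    exact Set.subset_univ _
  | tensor Γ Δ A B _ _ ih₁ ih₂ =>
    rw [hcons] at ih₁ ih₂ ⊢
    rw [Multiset.map_add, Multiset.sum_add]
    exact (Set.add_subset_add ih₁ ih₂).trans (subset_orth_orth _)
  | par Γ A B _ ih =>
    rw [hcons]
    rw [Multiset.map_cons, Multiset.sum_cons, Multiset.map_cons, Multiset.sum_cons,
      ← add_assoc] at ih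
    exact add_subset_iff.1 ih
  | plusLeft Γ A B _ ih =>
    rw [hcons] at ih ⊢
    exact (ih.trans Set.subset_union_left).trans (subset_orth_orth _)
  | plusRight Γ A B _ ih =>
    rw [hcons] at ih ⊢
    exact (ih.trans Set.subset_union_right).trans (subset_orth_orth _)
  | mu Γ β γ A hγ _ ih =>
    rw [hcons, eval_inst] at ih
    rw [hcons]
    simp only [eval] at ih ⊢
    rw [muIter]
    exact (ih.trans (Set.subset_iUnion (fun γ : Set.Iio β.1 =>
      eval P V A (scons (muIter P (fun X => eval P V A (scons X ρ)) γ.1) ρ))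
      ⟨γ.1, hγ⟩)).trans (subset_orth_orth _)
  | nu Γ β A _ ih =>
    rw [hcons]
    simp only [eval]
    rw [nuIter]
    refine Set.subset_iInter fun γ => ?_
    have := ih ⟨γ.1, (le_of_lt (Set.mem_Iio.1 γ.2)).trans (Set.mem_Iic.1 β.2)⟩ γ.2
    rw [hcons, eval_inst] at this
    exact this
  | _ Γ A B _ _ ih₁ ih₂ =>
    rw [hcons] at ih₁ ih₂ ⊢
    exact Set.subset_inter ih₁ ih₂

end Phase

/-! ### Derivations give halting computations -/

/-- States of registers together with tests.  The test `some X` asks whether the state lies in `X`;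
the test `none` serves to interpret variables. -/
abbrev TestState : Type := Multiset ℕ × Multiset (Option (Set (Multiset ℕ)))

/-- A state passes a single test `some X` if it lies in `X`; moreover the empty state passes the
pair of tests `none, none`, which makes `none` a self-dual element. -/
def testPole : Set TestState :=
  {m | (∃ X, m.1 ∈ X ∧ m.2 = {some X}) ∨ m = (0, {none, none})}

/-- A set of states, as a set of states without tests. -/
def states (H : Set (Multiset ℕ)) : Set TestState := {m | m.1 ∈ H ∧ m.2 = 0}

theorem states_mono {H H' : Set (Multiset ℕ)} (h : H ⊆ H') : states H ⊆ states H' :=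
  fun _ hm => ⟨h hm.1, hm.2⟩

/-- Every set of states is a fact, because it is recognized by a test. -/
theorem isFact_states (H : Set (Multiset ℕ)) : IsFact testPole (states H) := by
  refine Set.Subset.antisymm (fun m hm => ?_) (subset_orth_orth _)
  have h := hm (0, {some H}) (by
    rintro ⟨d, t⟩ ⟨hd, rfl : t = 0⟩
    exact .inl ⟨H, by simpa using hd, by simp⟩)
  rcases h with ⟨X, hX, h⟩ | h
  · have hm2 : m.2 = 0 := by
      have := congrArg Multiset.card h
      simpa using this
    refine ⟨?_, hm2⟩
    rw [Prod.snd_add, hm2, add_zero] at h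
    have : H = X := by simpa using h
    rw [this]
    simpa using hX
  · have := congrArg (fun m : TestState => some H ∈ m.2) h
    simp at this

theorem orth_none : orth testPole {(0, {none})} = {((0, {none}) : TestState)} := by
  ext ⟨d, t⟩
  simp only [orth, Set.mem_singleton_iff, forall_eq, Set.mem_ofPred_eq, testPole, Prod.mk_add_mk,
    zero_add, Multiset.singleton_add, Prod.mk.injEq, Multiset.insert_eq_cons,
    Multiset.cons_inj_right]
  constructor
  · rintro (⟨X, _, h⟩ | h)
    · have : none ∈ ({some X} : Multiset (Option (Set (Multiset ℕ)))) :=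
        h ▸ Multiset.mem_cons_self _ _
      simp at this
    · exact h
  · exact .inr

/-- The interpretation of formulas in which the literal `¬r` denotes the state with `1` in the
register `r` and `0` elsewhere. -/
noncomputable def evalStates {α : Ordinal.{u}} (A : OrdFml α) (ρ : ℕ → Set TestState) :
    Set TestState :=
  eval testPole (fun r => states {{r}}) A ρ

section

open Fml

variable {α : Ordinal.{u}} {ρ : ℕ → Set TestState}

theorem evalStates_consume_subset {r : ℕ} {A : OrdFml α} {H : Set (Multiset ℕ)}
    (h : evalStates A ρ ⊆ states H) :
    evalStates (tensor (nprop r) A) ρ ⊆ states {d | ∃ e ∈ H, d = r ::ₘ e} := by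
  refine (isFact_states _).orth_orth_subset (Set.add_subset_iff.2 fun x hx y hy => ?_)
  have hx : x ∈ states {{r}} := (isFact_states _).subset hx
  have hy := h hy
  refine ⟨⟨y.1, hy.1, ?_⟩, ?_⟩
  · rw [Prod.fst_add, hx.1, Multiset.singleton_add]
  · rw [Prod.snd_add, hx.2, hy.2, add_zero]

theorem evalStates_drain_subset (i : Set.Iic α) (r N : ℕ) :
    evalStates (drain i r N) ρ ⊆ states {d | r ∉ d} := by
  refine muIter_subset (isFact_states _) (fun X hX => ?_) _
  change evalStates (drainBody r N) (scons X ρ) ⊆ _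
  induction N with
  | zero =>
    refine (isFact_states _).orth_orth_subset ?_
    rintro _ rfl
    exact ⟨Multiset.notMem_zero r, rfl⟩
  | succ N ih =>
    simp only [drainBody]
    split_ifs with hN
    · exact ih
    · refine (isFact_states _).orth_orth_subset (Set.union_subset ?_ ih)
      refine (evalStates_consume_subset (ρ := scons X ρ) (A := var 0) hX).trans (states_mono ?_)
      rintro _ ⟨e, he, rfl⟩
      exact fun h => (Multiset.mem_cons.1 h).elim (fun h => hN h.symm) he

/-- The interpretation of `run i N p K` consists of states from which `p` reaches a state in the
interpretation of `K`. -/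
theorem evalStates_run_subset (i : Set.Iic α) (N : ℕ) (p : Prog) {K : OrdFml α}
    {H : Set (Multiset ℕ)} (h : evalStates K ρ ⊆ states H) :
    evalStates (run i N p K) ρ ⊆ states {d | ∃ d' ∈ H, p.Run d d'} := by
  induction p generalizing K H ρ with
  | skip => exact h.trans (states_mono fun d hd => ⟨d, hd, rfl⟩)
  | inc r =>
    intro m hm
    -- The state `r` is orthogonal to the interpretation of `prop r`.
    have hm' : (({r}, 0) : TestState) + m ∈ orth testPole (orth testPole (states H)) := by
      intro k hk
      rw [← add_assoc, add_comm k]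
      exact hm _ (Set.add_mem_add (subset_orth_orth _ ⟨rfl, rfl⟩) (orth_anti h hk))
    have := (isFact_states H).subset hm'
    refine ⟨⟨_, this.1, ?_⟩, by simpa using this.2⟩
    simp [Prog.Run]
  | seq p q ihp ihq =>
    refine (ihp (ihq h)).trans (states_mono ?_)
    rintro d ⟨e, ⟨d', hd', h₂⟩, h₁⟩
    exact ⟨d', hd', e, h₁, h₂⟩
  | loop r p ih =>
    refine muIter_subset (isFact_states _) (fun X hX => ?_) _
    refine (isFact_states _).orth_orth_subset (Set.union_subset ?_ ?_)
    · refine (evalStates_consume_subset (ih (ρ := scons X ρ) (K := var 0) hX)).trans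
        (states_mono ?_)
      rintro _ ⟨d, ⟨e, ⟨d', hd', h₂⟩, h₁⟩, rfl⟩
      exact ⟨d', hd', .step _ _ _ h₁ h₂⟩
    · rintro m ⟨hm, hm'⟩
      have h₁ := evalStates_drain_subset (ρ := scons X ρ) i r N hm
      rw [eval_rename] at hm'
      exact ⟨⟨m.1, (h hm').1, .done _ h₁.1⟩, h₁.2⟩

theorem exists_run_of_provable (i j : Set.Iic α) {N : ℕ} {p : Prog} {d : Multiset ℕ}
    (h : Provable α (run i N p (drain j N N) ::ₘ d.map prop)) : ∃ d', p.Run d d' := by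
  let ρ : ℕ → Set TestState := fun _ => {(0, {none})}
  have hρ : ∀ n, orth testPole (ρ n) = ρ n := fun _ => orth_none
  have hs := h.sound (V := fun r => states {{r}}) hρ
  rw [Multiset.map_cons, Multiset.sum_cons, add_subset_iff,
    isFact_eval _ fun n => by rw [IsFact, hρ n, hρ n]] at hs
  have hd : ∀ d : Multiset ℕ, ((d, 0) : TestState) ∈ ((d.map (prop : ℕ → OrdFml α)).map fun A =>
      orth testPole (eval testPole (fun r => states {{r}}) A ρ)).sum := fun d => by
    induction d using Multiset.induction_on with
    | empty => exact rfl
    | cons r d ih =>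
      rw [Multiset.map_cons, Multiset.map_cons, Multiset.sum_cons]
      have : ((r ::ₘ d, 0) : TestState) = ({r}, 0) + (d, 0) := by simp
      rw [this]
      exact Set.add_mem_add (subset_orth_orth _ ⟨rfl, rfl⟩) ih
  obtain ⟨⟨d', _, hd'⟩, _⟩ :=
    evalStates_run_subset i N p (evalStates_drain_subset j N N) (hs (hd d))
  exact ⟨d', hd'⟩

end

end MuMALL

/-! ### The reductions -/

namespace MuMALL

theorem PlainFml.code_injective : Function.Injective PlainFml.code := by
  intro A B h
  induction A generalizing B <;> cases B <;>
    simp_all [PlainFml.code, Nat.pair_eq_pair] <;> grind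

theorem seqCode_injective : Function.Injective seqCode := fun _ _ h =>
  PlainFml.code_injective.list_map (Encodable.encode_injective h)

theorem seqCode_mem_Th {α : Ordinal.{u}} {Γ : List PlainFml} :
    seqCode Γ ∈ Th α ↔ Provable α (Γ.map (PlainFml.toOrd α) : Multiset (OrdFml α)) := by
  refine ⟨?_, fun h => ⟨Γ, rfl, h⟩⟩
  rintro ⟨Δ, h, hΔ⟩
  rwa [seqCode_injective h]

theorem primrec_seqCode_cons_replicate (A B : PlainFml) :
    Primrec fun n => seqCode (A :: List.replicate n B) := by
  have h : Primrec fun n : ℕ =>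
      Encodable.encode (A.code :: (List.range n).map fun _ => B.code) :=
    Primrec.encode.comp (Primrec.list_cons.comp (Primrec.const _)
      (Primrec.list_map Primrec.list_range (Primrec.const B.code).to₂))
  refine h.of_eq fun n => ?_
  simp [seqCode]

theorem sigmaOneHardManyOne_Th {α : Ordinal.{u}} (hα : Ordinal.omega0 ≤ α) :
    SigmaOneHardManyOne (Th α) := by
  intro P hP
  obtain ⟨p, hp⟩ := exists_prog_of_rePred hP
  obtain ⟨N₀, hN₀⟩ := p.exists_bounded
  -- The bound must exceed the input register `0` even if the program does not name it.
  let N := N₀ + 1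
  have hN : p.Bounded N := hN₀.mono (Nat.le_succ N₀)
  refine ⟨fun n => seqCode (Fml.run () N p (Fml.drain () N N) :: List.replicate n (.prop 0)),
    (primrec_seqCode_cons_replicate _ _).to_comp, fun n => ?_⟩
  let a : Set.Iic α := ⟨α, le_refl α⟩
  have hseq : (((Fml.run () N p (Fml.drain () N N) :: List.replicate n (.prop 0)).map
      (PlainFml.toOrd α) : List (OrdFml α)) : Multiset (OrdFml α)) =
      Fml.run a N p (Fml.drain a N N) ::ₘ (Multiset.replicate n 0).map .prop := by
    rw [List.map_cons, List.map_replicate, Multiset.map_replicate, ← Multiset.cons_coe,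
      Multiset.coe_replicate]
    simp only [PlainFml.toOrd, Fml.mapAnn_run, Fml.mapAnn_drain, Fml.mapAnn]
    rfl
  refine (hp n).trans (Iff.trans ?_ seqCode_mem_Th.symm)
  rw [hseq]
  refine ⟨?_, exists_run_of_provable a a⟩
  rintro ⟨d', hd'⟩
  have hd : ∀ s ∈ Multiset.replicate n 0, s < N := fun s hs => by
    rw [Multiset.eq_of_mem_replicate hs]; exact Nat.succ_pos N₀
  have hd'N := hd'.lt_of_mem hN hd
  exact provable_run hα hN hd hd' _ (provable_drain hα d' hd'N
    (fun h => lt_irrefl N (hd'N N h)) a ((Ordinal.natCast_lt_omega0 _).trans_le hα))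

end MuMALL

theorem rePred_emptyJump : REPred fun n => n ∈ emptyJump := by
  have h : Partrec fun n : ℕ => (Denumerable.ofNat Nat.Partrec.Code n).eval n :=
    Nat.Partrec.Code.eval_part.comp (Computable.ofNat _) Computable.id
  exact h.dom_re

theorem turingReducible_oracleOf_of_manyOneReducible {S T : Set ℕ}
    (h : ManyOneReducible (fun n => n ∈ S) fun n => n ∈ T) :
    TuringReducible (oracleOf S) (oracleOf T) := by
  obtain ⟨f, hf, hfS⟩ := h
  have hf' : Nat.RecursiveIn {oracleOf T} (f : ℕ →. ℕ) :=
    (Partrec.nat_iff.1 hf).recursiveIn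
  refine RecursiveIn.iff_nat.2
    (((Nat.RecursiveIn.oracle (oracleOf T) (Set.mem_singleton _)).comp hf').of_eq fun n => ?_)
  refine (Part.bind_some (f n) (oracleOf T)).trans ?_
  have : f n ∈ T ↔ n ∈ S := (hfS n).symm
  by_cases hn : n ∈ S <;> simp [oracleOf, this, hn]

theorem mainTheorem9 (α : Ordinal.{u}) (hα : Ordinal.omega0 ≤ α) :
    SigmaOneHardManyOne (MuMALL.Th α) ∧ SigmaOneHardTuring (MuMALL.Th α) := by
  have h := MuMALL.sigmaOneHardManyOne_Th hα
  exact ⟨h, turingReducible_oracleOf_of_manyOneReducible (h _ rePred_emptyJump)⟩
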